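/- Let $G$ be a simple complex algebraic group of rank $r$ (a connected linear algebraic group over $\mathbb C$ whose Lie algebra $\mathfrak g$ is simple), with Chevalley generators $h_i,x_i^\pm$ $(1\le i\le r)$ of $\mathfrak g$ and Cartan matrix $C$, normalised by $[h_i,x_j^\pm]=\pm C_{ij}x_j^\pm$ and $[x_i^+,x_j^-]=\delta_{ij}h_i$. Let $h^1,\dots,h^r$ be the elements of the Cartan subalgebra with $h_i=\sum_j C_{ij}h^j$. Let $\varphi_i:SL_2(\mathbb C)\to G$ be the homomorphism whose differential sends the standard basis $E,H,F$ of $\mathfrak{sl}_2$ to $x_i^+,h_i,x_i^-$. Fix an ordering $(i_1,\dots,i_r)$ of $\{1,\dots,r\}$ (a reduced word of a Coxeter element), and let $V$ be a finite-dimensional representation of $G$. For $\chi=(\chi^+,\chi^-)\in(\mathbb C^\times)^{2r}$ put $$\mathrm{Ch}_V(\chi^+,\chi^-)=\mathrm{Tr}_V\Big(\prod_{j=1}^r\Big(\frac{\chi_j^+}{\chi_j^-}\Big)^{h^j}\varphi_{i_1}(g_{i_1})\cdots\varphi_{i_r}(g_{i_r})\Big),\qquad g_i=\begin{pmatrix}1-\chi_i^-&\chi_i^-\\-1&1\end{pmatrix}.$$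 Here $\prod_j(\chi_j^+/\chi_j^-)^{h^j}=\exp\big(\sum_j\ell_jh^j\big)$, where $\ell_j$ is a value of $\log(\chi^+_j/\chi^-_j)$. In general $\mathrm{Ch}_V$ is therefore multivalued, with branches $\mathrm{Ch}_V^{\ell}(\chi)$ labelled by $\ell=(\ell_1,\dots,\ell_r)$. Let $\alpha$ be the discrete Toda map $$\alpha(\chi_i^+)=\chi_i^-,\qquad \alpha(\chi_i^-)=\frac{(\chi_i^-)^2}{\chi_i^+}\prod_{j=1}^r(1-\chi_j^-)^{-C_{ji}},$$ defined on the points of $(\mathbb C^\times)^{2r}$ with $\chi_j^-\ne1$ for all $j$. Then $\mathrm{Ch}_V(\alpha(\chi^+),\alpha(\chi^-))=\mathrm{Ch}_V(\chi^+,\chi^-)$ on this domain, in the following sense. 1. If $e^{\ell_j}=\chi_j^+/\chi_j^-$ and $e^{m_j}=1-\chi_j^-$ for all $j$, then $\ell'_j=\ell_j+\sum_kC_{kj}m_k$ is a value of $\log\big(\alpha(\chi^+_j)/\alpha(\chi^-_j)\big)$ for every $j$, and $\mathrm{Ch}_V^{\ell'}(\alpha(\chi))=\mathrm{Ch}_V^{\ell}(\chi)$.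 2. The set of all values of $\mathrm{Ch}_V$ at $\alpha(\chi)$ equals the set of all values of $\mathrm{Ch}_V$ at $\chi$. 3. If all $\exp(2\pi\sqrt{-1}\,h^j)$ act trivially on $V$ (for instance, if $G$ is of adjoint type), then $\mathrm{Ch}_V$ is single-valued and $\mathrm{Ch}_V(\alpha(\chi))=\mathrm{Ch}_V(\chi)$. In other words, $\mathrm{Ch}_V$ is an integral of the dynamics given by $\alpha$. -/

import Mathlib

open scoped MatrixGroups
attribute [local instance 100] LieRing.ofAssociativeRing

noncomputable section

namespace CoxeterToda

/-- The exponential of a complex square matrix, as an element of the general linear group. -/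
def expGL {n : ℕ} (X : Matrix (Fin n) (Fin n) ℂ) : GL (Fin n) ℂ :=
  (Matrix.isUnit_exp X).unit

/-- `G` is the zero locus in `GL n ℂ` of a set of polynomials in the matrix entries. -/
def IsZariskiClosed {n : ℕ} (G : Subgroup (GL (Fin n) ℂ)) : Prop :=
  ∃ S : Set (MvPolynomial (Fin n × Fin n) ℂ), ∀ g : GL (Fin n) ℂ,
    g ∈ G ↔ ∀ f ∈ S,
      MvPolynomial.eval (fun p : Fin n × Fin n => (g : Matrix (Fin n) (Fin n) ℂ) p.1 p.2) f = 0

/-- `G` is a simple complex algebraic group (a connected linear algebraic group whose Lie algebra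
is simple), and `𝔤` is its Lie algebra `{X | exp (t X) ∈ G for all t}`. -/
structure IsSimpleAlgebraicGroup {n : ℕ} (G : Subgroup (GL (Fin n) ℂ))
    (𝔤 : LieSubalgebra ℂ (Matrix (Fin n) (Fin n) ℂ)) : Prop where
  zariskiClosed : IsZariskiClosed G
  connected : IsConnected (G : Set (GL (Fin n) ℂ))
  mem_lie_iff : ∀ X : Matrix (Fin n) (Fin n) ℂ, X ∈ 𝔤 ↔ ∀ t : ℂ, expGL (t • X) ∈ G
  simple : LieAlgebra.IsSimple ℂ 𝔤

/-- The exponential map `𝔤 → G`. -/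
def expG {n : ℕ} {G : Subgroup (GL (Fin n) ℂ)}
    {𝔤 : LieSubalgebra ℂ (Matrix (Fin n) (Fin n) ℂ)} (hG : IsSimpleAlgebraicGroup G 𝔤)
    (X : 𝔤) : G :=
  ⟨expGL (X : Matrix (Fin n) (Fin n) ℂ), by
    have := (hG.mem_lie_iff X).1 X.2 1
    rwa [one_smul] at this⟩

/-- `h i`, `xp i = x_i⁺`, `xm i = x_i⁻` are Chevalley generators of the Lie algebra `L`, with
Cartan matrix `C`, normalised by `[h_i, x_j^±] = ± C_{ij} x_j^±`. -/
structure IsChevalleyGenerators {r : ℕ} {L : Type*} [LieRing L] [LieAlgebra ℂ L]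
    (C : Matrix (Fin r) (Fin r) ℤ) (h xp xm : Fin r → L) : Prop where
  diag : ∀ i, C i i = 2
  h_h : ∀ i j, ⁅h i, h j⁆ = 0
  xp_xm : ∀ i j, ⁅xp i, xm j⁆ = if i = j then h i else 0
  h_xp : ∀ i j, ⁅h i, xp j⁆ = (C i j : ℂ) • xp j
  h_xm : ∀ i j, ⁅h i, xm j⁆ = -((C i j : ℂ) • xm j)
  serre_xp : ∀ i j, i ≠ j → ((LieAlgebra.ad ℂ L (xp i)) ^ (1 - C i j).toNat) (xp j) = 0
  serre_xm : ∀ i j, i ≠ j → ((LieAlgebra.ad ℂ L (xm i)) ^ (1 - C i j).toNat) (xm j) = 0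
  linearIndependent : LinearIndependent ℂ h
  generate : LieSubalgebra.lieSpan ℂ L (Set.range xp ∪ Set.range xm) = ⊤

/-- The elements `h^j` of the Cartan subalgebra dual to the simple roots, determined by
`h_i = ∑ j, C_{ij} h^j`; explicitly `h^j = ∑ i, (C⁻¹)_{ji} h_i`. -/
def fundCoweight {r : ℕ} {L : Type*} [LieRing L] [LieAlgebra ℂ L]
    (C : Matrix (Fin r) (Fin r) ℤ) (h : Fin r → L) (j : Fin r) : L :=
  ∑ i, (C.map (Int.cast : ℤ → ℂ))⁻¹ j i • h i

/-- `φ : SL₂(ℂ) → G` is the homomorphism of Lie groups whose differential sends the standard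
basis `E, H, F` of `𝔰𝔩₂` to `xp, h, xm`, that is, `φ (exp A) = exp (dφ A)` for all `A ∈ 𝔰𝔩₂`.
Since `SL₂(ℂ)` is generated by exponentials, this determines `φ`. -/
def IsSL2Embedding {n : ℕ} {G : Subgroup (GL (Fin n) ℂ)}
    {𝔤 : LieSubalgebra ℂ (Matrix (Fin n) (Fin n) ℂ)} (hG : IsSimpleAlgebraicGroup G 𝔤)
    (h xp xm : 𝔤) (φ : SL(2, ℂ) →* G) : Prop :=
  ∀ (a b c : ℂ) (g : SL(2, ℂ)),
    (g : Matrix (Fin 2) (Fin 2) ℂ) = NormedSpace.exp !![a, b; c, -a] →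
      φ g = expG hG (a • h + b • xp + c • xm)

/-- The element `g_i` of `SL₂(ℂ)`, as a function of `x = χ⁻_i`. -/
def gElem (x : ℂ) : SL(2, ℂ) :=
  ⟨!![1 - x, x; -1, 1], by rw [Matrix.det_fin_two_of]; ring⟩

/-- Points `(χ⁺, χ⁻)`. -/
abbrev Point (r : ℕ) : Type := (Fin r → ℂ) × (Fin r → ℂ)

/-- The points of `(ℂˣ)^{2r}` outside the hyperplanes `χ⁻_j = 1`, where `α` is defined. -/
def InDomain {r : ℕ} (χ : Point r) : Prop :=
  ∀ j, χ.1 j ≠ 0 ∧ χ.2 j ≠ 0 ∧ χ.2 j ≠ 1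

/-- The discrete Toda map `α`. -/
def todaMap {r : ℕ} (C : Matrix (Fin r) (Fin r) ℤ) (χ : Point r) : Point r :=
  (fun i => χ.2 i, fun i => χ.2 i ^ 2 / χ.1 i * ∏ j, (1 - χ.2 j) ^ (-C j i))

/-- The graph of `α`, as a relation. -/
def todaRel {r : ℕ} (C : Matrix (Fin r) (Fin r) ℤ) (χ χ' : Point r) : Prop :=
  InDomain χ ∧ χ' = todaMap C χ

/-- `F` is an integral of the dynamics given by the relation `R`. -/
def IsIntegralOf {X Y : Type*} (R : X → X → Prop) (F : X → Y) : Prop :=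
  ∀ x y, R x y → F x = F y

/-- `ℓ j` is a value of `log (χ⁺_j / χ⁻_j)` for every `j`. -/
def IsLogRatio {r : ℕ} (ℓ : Fin r → ℂ) (χ : Point r) : Prop :=
  ∀ j, Complex.exp (ℓ j) = χ.1 j / χ.2 j

section Character

variable {n r : ℕ} {G : Subgroup (GL (Fin n) ℂ)}
  {𝔤 : LieSubalgebra ℂ (Matrix (Fin n) (Fin n) ℂ)} (hG : IsSimpleAlgebraicGroup G 𝔤)
  (C : Matrix (Fin r) (Fin r) ℤ) (h : Fin r → 𝔤) (φ : Fin r → SL(2, ℂ) →* G)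
  (σ : Equiv.Perm (Fin r)) {V : Type*} [AddCommGroup V] [Module ℂ V] (ρ : Representation ℂ G V)

/-- The element `∏ j, (χ⁺_j/χ⁻_j)^{h^j} * φ_{i_1}(g_{i_1}) ⋯ φ_{i_r}(g_{i_r})` of `G`, where
`i_k = σ k` and `z_j ^ {h^j} = exp (ℓ_j h^j)` for the given values `ℓ_j` of `log z_j`. -/
def groupElem (ℓ : Fin r → ℂ) (χ : Point r) : G :=
  expG hG (∑ j, ℓ j • fundCoweight C h j) *
    (List.ofFn fun k => φ (σ k) (gElem (χ.2 (σ k)))).prod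

/-- The branch of `Ch_V` at `χ` belonging to the values `ℓ_j` of `log (χ⁺_j/χ⁻_j)`. -/
def chBranch (ℓ : Fin r → ℂ) (χ : Point r) : ℂ :=
  LinearMap.trace ℂ V (ρ (groupElem hG C h φ σ ℓ χ))

/-- The multivalued function `Ch_V`: the set of its values at `χ`. -/
def chValues (χ : Point r) : Set ℂ :=
  {c | ∃ ℓ : Fin r → ℂ, IsLogRatio ℓ χ ∧ c = chBranch hG C h φ σ ρ ℓ χ}

/-- The value of `Ch_V` at `χ` for the principal values of the logarithms. -/
def ch (χ : Point r) : ℂ :=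
  chBranch hG C h φ σ ρ (fun j => Complex.log (χ.1 j / χ.2 j)) χ

/-- All `z ^ {h^j}` are single-valued on `V`: the elements `exp (2πi h^j)` act trivially. This
holds for every representation if `G` is of adjoint type. -/
def CoweightsIntegral : Prop :=
  ∀ j, ρ (expG hG ((2 * Real.pi * Complex.I : ℂ) • fundCoweight C h j)) = 1

end Character

end CoxeterToda

end

namespace CoxeterToda

/-! ### Exponentials of matrices. -/

section MatrixExp

open scoped Matrix.Norms.Operator

/-! The trace sees only the conjugacy class, so it suffices that the group elements at `χ` and at
its image are conjugate. Write `e_i`, `f_i` for the root subgroups and `T` for the torus in coweight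
coordinates. In `SL₂`, `g_i = e_i(x) f_i(-1)`, and when `e^m = 1 - x` it equals `exp(m h_i)
f_i(-e^m) e_i(x e^{-m})`. Use this at every factor, collect the torus parts on the left, and move
each `e_i` past the later `f_j`, which commute with it. This gives `T(ℓ') F E`, where `ℓ'` is the
Toda shift of `ℓ`.

The `f` and `e` parameters are `-e^{s_k}` and `x_k e^{-s_k}`, so conjugation by `T(s)` makes them
`-1` and `x_k`. Cycling `E` to the front and then through `T(ℓ')` scales its parameters to `x_k
e^{-ℓ'_k}`, which are the new `χ⁻_k`; interleaving the factors again restores the Coxeter product.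

The relations used are isolated in `IsPinning`; `exists_list_prod_exchange` does the factorisation
and `isConj_coxeter` the conjugation. -/

theorem matrix_semiconjBy_exp {n : ℕ} {x a b : Matrix (Fin n) (Fin n) ℂ}
    (hab : SemiconjBy x a b) : SemiconjBy x (NormedSpace.exp a) (NormedSpace.exp b) :=
  hab.exp_right

theorem matrix_exp_of_sq_eq_zero {n : ℕ} (N : Matrix (Fin n) (Fin n) ℂ) (hN : N ^ 2 = 0) :
    NormedSpace.exp N = 1 + N := by
  rw [NormedSpace.exp_eq_tsum ℂ]
  simp only
  rw [tsum_eq_sum (s := Finset.range 2)]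
  · simp [Finset.sum_range_succ]
  · intro k hk
    have : 2 ≤ k := by simpa [Nat.lt_iff_add_one_le] using hk
    rw [pow_eq_zero_of_le this hN, smul_zero]

theorem matrix_exp_smul_one {n : ℕ} (c : ℂ) :
    NormedSpace.exp (c • (1 : Matrix (Fin n) (Fin n) ℂ)) = Complex.exp c • 1 := by
  rw [Matrix.smul_one_eq_diagonal, Matrix.exp_diagonal, Matrix.smul_one_eq_diagonal]
  congr 1
  ext i
  simp [Pi.coe_exp, Complex.exp_eq_exp_ℂ]

end MatrixExp

/-- If `[X, Y] = c Y`, then `exp X` conjugates `exp (t Y)` to `exp (t e^c Y)`. -/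
theorem matrix_exp_semiconjBy_exp {n : ℕ} {X Y : Matrix (Fin n) (Fin n) ℂ} {c : ℂ}
    (hXY : X * Y - Y * X = c • Y) (t : ℂ) :
    SemiconjBy (NormedSpace.exp X) (NormedSpace.exp (t • Y))
      (NormedSpace.exp ((Complex.exp c * t) • Y)) := by
  -- The bracket relation says `Y (X + c) = X Y`; exponentiating it moves `Y` past `exp X` at the
  -- cost of `e^c`.
  have h1 : SemiconjBy Y (X + c • 1) X := by
    rw [SemiconjBy, mul_add, mul_smul_comm, mul_one, ← hXY]
    abel
  have h2 := (matrix_semiconjBy_exp h1).eq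
  rw [Matrix.exp_add_of_commute _ _ ((Commute.one_right X).smul_right c), matrix_exp_smul_one,
    mul_smul_comm, mul_one, mul_smul_comm] at h2
  apply matrix_semiconjBy_exp
  rw [SemiconjBy, mul_smul_comm, smul_mul_assoc, ← h2, smul_smul, mul_comm t]

/-! ### The conjugation argument for Coxeter products. -/

/-- One-parameter subgroups `e i`, `f i` of a group and a torus `T`, in coordinates dual to the
simple roots, which satisfy the commutation relations of a semisimple group with Cartan matrix
`C`. -/
structure IsPinning {r : ℕ} {Γ : Type*} [Group Γ] (C : Matrix (Fin r) (Fin r) ℤ)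
    (T : (Fin r → ℂ) → Γ) (e f : Fin r → ℂ → Γ) : Prop where
  torus_add : ∀ a b, T (a + b) = T a * T b
  torus_e : ∀ a i t, SemiconjBy (T a) (e i t) (e i (Complex.exp (a i) * t))
  torus_f : ∀ a i t, SemiconjBy (T a) (f i t) (f i (Complex.exp (-a i) * t))
  commute : ∀ i j s t, i ≠ j → Commute (e i s) (f j t)
  exchange : ∀ i x m, Complex.exp m = 1 - x →
    e i x * f i (-1) =
      T (fun j => (C i j : ℂ) * m) * (f i (-Complex.exp m) * e i (x * Complex.exp (-m)))

theorem semiconjBy_list_map_prod {ι Γ : Type*} [Monoid Γ] {c : Γ} {u v : ι → Γ} (L : List ι)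
    (huv : ∀ i ∈ L, SemiconjBy c (u i) (v i)) :
    SemiconjBy c (L.map u).prod (L.map v).prod := by
  induction L with
  | nil => exact SemiconjBy.one_right c
  | cons i L ih =>
    simp only [List.map_cons, List.prod_cons]
    exact (huv i (by simp)).mul_right (ih fun j hj => huv j (by simp [hj]))

/-- Each `v i` only has to pass the `u j` that come later, and these have `j ≠ i` because the list
has no repetitions. -/
theorem list_prod_mul_of_commute {ι Γ : Type*} [Monoid Γ] {u v : ι → Γ} {L : List ι}
    (hL : L.Nodup) (huv : ∀ i j, i ≠ j → Commute (u i) (v j)) :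
    (L.map fun i => u i * v i).prod = (L.map u).prod * (L.map v).prod := by
  induction L with
  | nil => simp
  | cons i L ih =>
    rw [List.nodup_cons] at hL
    have h1 : Commute (v i) (L.map u).prod :=
      semiconjBy_list_map_prod L fun j hj => (huv j i (by rintro rfl; exact hL.1 hj)).symm
    simp only [List.map_cons, List.prod_cons, ih hL.2]
    rw [mul_assoc, ← mul_assoc (v i), h1.eq, mul_assoc, mul_assoc]

namespace IsPinning

variable {r : ℕ} {Γ : Type*} [Group Γ] {C : Matrix (Fin r) (Fin r) ℤ}
  {T : (Fin r → ℂ) → Γ} {e f : Fin r → ℂ → Γ}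

/-- The value of `s` depends on the order of the list, but only its opposite signs in the `f` and
`e` parameters matter: one torus conjugation removes both. -/
theorem exists_list_prod_exchange (hP : IsPinning C T e f) {x m : Fin r → ℂ}
    (hm : ∀ k, Complex.exp (m k) = 1 - x k) (L : List (Fin r)) (hL : L.Nodup) :
    ∃ s : Fin r → ℂ, (L.map fun k => e k (x k) * f k (-1)).prod =
      T (fun j => (L.map fun k => (C k j : ℂ) * m k).sum) *
        ((L.map fun k => f k (-Complex.exp (s k))).prod *
          (L.map fun k => e k (x k * Complex.exp (-s k))).prod) := by
  induction L with
  | nil =>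
    have h0 : T (fun _ => 0) = 1 := by
      have h := hP.torus_add 0 0
      rw [add_zero] at h
      exact left_eq_mul.1 h
    exact ⟨0, by simpa using h0.symm⟩
  | cons i L ih =>
    rw [List.nodup_cons] at hL
    obtain ⟨s, hs⟩ := ih hL.2
    set τ : Fin r → ℂ := fun j => (L.map fun k => (C k j : ℂ) * m k).sum with hτ
    have hcongr {M : Type _} (u : Fin r → ℂ → M) (c : ℂ) :
        (L.map fun k => u k (Function.update s i c k)) = L.map fun k => u k (s k) :=
      List.map_congr_left fun k hk => by
        rw [Function.update_of_ne (by rintro rfl; exact hL.1 hk)]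
    -- The exchange at `i` contributes `m i`; pulling the tail's torus factor `T τ` left past `f i`
    -- and `e i` adds `τ i`.
    refine ⟨Function.update s i (m i + τ i), ?_⟩
    simp only [List.map_cons, List.prod_cons, List.sum_cons, Function.update_self]
    rw [hcongr (fun k c => f k (-Complex.exp c)), hcongr (fun k c => e k (x k * Complex.exp (-c))),
      hs, hP.exchange i (x i) (m i) (hm i)]
    have hadd := hP.torus_add (fun j => (C i j : ℂ) * m i) τ
    have hsplit : (fun j => (C i j : ℂ) * m i + (L.map fun k => (C k j : ℂ) * m k).sum) =
        (fun j => (C i j : ℂ) * m i) + τ := rfl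
    have he := hP.torus_e τ i (x i * Complex.exp (-(m i + τ i)))
    have hf := hP.torus_f τ i (-Complex.exp (m i + τ i))
    have h1 : Complex.exp (τ i) * (x i * Complex.exp (-(m i + τ i))) =
        x i * Complex.exp (-m i) := by
      rw [mul_left_comm, ← Complex.exp_add]; congr 2; ring
    have h2 : Complex.exp (-τ i) * -Complex.exp (m i + τ i) = -Complex.exp (m i) := by
      rw [mul_neg, ← Complex.exp_add]; congr 2; ring
    rw [h1] at he
    rw [h2] at hf
    have hc : Commute (e i (x i * Complex.exp (-(m i + τ i))))
        (L.map fun k => f k (-Complex.exp (s k))).prod :=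
      semiconjBy_list_map_prod L fun k hk =>
        hP.commute i k _ _ (by rintro rfl; exact hL.1 hk)
    rw [hsplit, hadd]
    generalize (L.map fun k => f k (-Complex.exp (s k))).prod = F at *
    generalize (L.map fun k => e k (x k * Complex.exp (-s k))).prod = E at *
    simp only [mul_assoc]
    congr 1
    rw [← mul_assoc (e i _) (T τ), ← he.eq, mul_assoc, ← mul_assoc (f i _) (T τ), ← hf.eq,
      mul_assoc, ← mul_assoc (e i _) F, hc.eq, mul_assoc]

/-- The Coxeter product is conjugate to the Coxeter product with shifted parameters. -/
theorem isConj_coxeter (hP : IsPinning C T e f) {x m ℓ ℓ' : Fin r → ℂ}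
    (hm : ∀ k, Complex.exp (m k) = 1 - x k) (L : List (Fin r)) (hL : L.Nodup)
    (hℓ' : ∀ j, ℓ' j = ℓ j + (L.map fun k => (C k j : ℂ) * m k).sum) :
    IsConj (T ℓ * (L.map fun k => e k (x k) * f k (-1)).prod)
      (T ℓ' * (L.map fun k => e k (x k * Complex.exp (-ℓ' k)) * f k (-1)).prod) := by
  obtain ⟨s, hs⟩ := hP.exists_list_prod_exchange hm L hL
  have hT : T ℓ' = T ℓ * T (fun j => (L.map fun k => (C k j : ℂ) * m k).sum) := by
    rw [← hP.torus_add]; congr 1; ext j; exact hℓ' j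
  rw [hs, ← mul_assoc, ← hT,
    list_prod_mul_of_commute hL fun i j hij => hP.commute i j _ _ hij]
  have hF : SemiconjBy (T s) (L.map fun k => f k (-Complex.exp (s k))).prod
      (L.map fun k => f k (-1)).prod := by
    refine semiconjBy_list_map_prod L fun k _ => ?_
    have := hP.torus_f s k (-Complex.exp (s k))
    rwa [mul_neg, ← Complex.exp_add, neg_add_cancel, Complex.exp_zero] at this
  have hE : SemiconjBy (T s) (L.map fun k => e k (x k * Complex.exp (-s k))).prod
      (L.map fun k => e k (x k)).prod := by
    refine semiconjBy_list_map_prod L fun k _ => ?_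
    have := hP.torus_e s k (x k * Complex.exp (-s k))
    rwa [mul_left_comm, ← Complex.exp_add, add_neg_cancel, Complex.exp_zero, mul_one] at this
  have hTT : SemiconjBy (T s) (T ℓ') (T ℓ') := by
    rw [SemiconjBy, ← hP.torus_add, ← hP.torus_add, add_comm]
  have hE' : SemiconjBy (T ℓ') (L.map fun k => e k (x k * Complex.exp (-ℓ' k))).prod
      (L.map fun k => e k (x k)).prod := by
    refine semiconjBy_list_map_prod L fun k _ => ?_
    have := hP.torus_e ℓ' k (x k * Complex.exp (-ℓ' k))
    rwa [mul_left_comm, ← Complex.exp_add, add_neg_cancel, Complex.exp_zero, mul_one] at this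
  -- Conjugation by `T s` normalises the parameters; conjugation by the product of the `e k (x k)`
  -- then cycles it to the front, where `hE'` carries it through `T ℓ'`.
  refine IsConj.trans (isConj_iff.2 ⟨T s, mul_inv_eq_of_eq_mul
    (hTT.mul_right (hF.mul_right hE)).eq⟩) (isConj_iff.2 ⟨(L.map fun k => e k (x k)).prod, ?_⟩)
  rw [← mul_assoc (T ℓ') _ (L.map fun k => f k (-1)).prod, hE'.eq]
  group

end IsPinning

/-! ### The exponential map into the group. -/

section Exponential

variable {n : ℕ} {G : Subgroup (GL (Fin n) ℂ)} {𝔤 : LieSubalgebra ℂ (Matrix (Fin n) (Fin n) ℂ)}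
  (hG : IsSimpleAlgebraicGroup G 𝔤)

theorem group_ext {a b : G}
    (hab : ((a : GL (Fin n) ℂ) : Matrix (Fin n) (Fin n) ℂ) = ((b : GL (Fin n) ℂ))) : a = b :=
  Subtype.ext (Units.ext hab)

theorem commute_coe_of_lie_eq_zero {X Y : 𝔤} (hXY : ⁅X, Y⁆ = 0) :
    Commute (X : Matrix (Fin n) (Fin n) ℂ) Y := by
  have h := congrArg (Subtype.val) hXY
  rw [LieSubalgebra.coe_bracket, Ring.lie_def] at h
  exact sub_eq_zero.1 h

theorem expG_add {X Y : 𝔤} (hXY : ⁅X, Y⁆ = 0) :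
    expG hG (X + Y) = expG hG X * expG hG Y :=
  group_ext (Matrix.exp_add_of_commute _ _ (commute_coe_of_lie_eq_zero hXY))

theorem commute_expG {X Y : 𝔤} (hXY : ⁅X, Y⁆ = 0) : Commute (expG hG X) (expG hG Y) := by
  have hYX : ⁅Y, X⁆ = 0 := by rw [← lie_skew, hXY, neg_zero]
  rw [Commute, SemiconjBy, ← expG_add hG hXY, ← expG_add hG hYX, add_comm]

theorem semiconjBy_expG {X Y : 𝔤} {c : ℂ} (hXY : ⁅X, Y⁆ = c • Y) (t : ℂ) :
    SemiconjBy (expG hG X) (expG hG (t • Y)) (expG hG ((Complex.exp c * t) • Y)) := by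
  have h := congrArg (Subtype.val) hXY
  rw [LieSubalgebra.coe_bracket, Ring.lie_def] at h
  exact group_ext (matrix_exp_semiconjBy_exp h t).eq

end Exponential

/-! ### Coweights and the Cartan matrix. -/

section Cartan

variable {r : ℕ} {L : Type*} [LieRing L] [LieAlgebra ℂ L] {C : Matrix (Fin r) (Fin r) ℤ}
  {h xp xm : Fin r → L}

theorem eq_zero_of_forall_lie_eq_zero (hL : LieAlgebra.IsSimple ℂ L) {z : L}
    (hz : ∀ y : L, ⁅y, z⁆ = 0) : z = 0 := by
  have hmem : z ∈ LieAlgebra.center ℂ L := (LieModule.mem_maxTrivSubmodule ℂ L L z).2 hz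
  rcases hL.eq_bot_or_eq_top (LieAlgebra.center ℂ L) with hbot | htop
  · rwa [hbot, LieSubmodule.mem_bot] at hmem
  · exact absurd ((LieAlgebra.isLieAbelian_iff_center_eq_top ℂ L).2 htop) hL.non_abelian

theorem IsChevalleyGenerators.sum_smul_lie_xp (hC : IsChevalleyGenerators C h xp xm)
    (v : Fin r → ℂ) (j : Fin r) :
    ⁅∑ i, v i • h i, xp j⁆ = (∑ i, v i * (C i j : ℂ)) • xp j := by
  simp only [sum_lie, smul_lie, hC.h_xp, smul_smul, Finset.sum_smul]

theorem IsChevalleyGenerators.sum_smul_lie_xm (hC : IsChevalleyGenerators C h xp xm)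
    (v : Fin r → ℂ) (j : Fin r) :
    ⁅∑ i, v i • h i, xm j⁆ = (-∑ i, v i * (C i j : ℂ)) • xm j := by
  simp only [sum_lie, smul_lie, hC.h_xm, smul_neg, smul_smul, Finset.sum_smul, neg_smul,
    Finset.sum_neg_distrib]

/-- The Cartan matrix is invertible, since a simple Lie algebra has trivial centre. -/
theorem IsChevalleyGenerators.isUnit_det (hC : IsChevalleyGenerators C h xp xm)
    (hL : LieAlgebra.IsSimple ℂ L) : IsUnit (C.map (Int.cast : ℤ → ℂ)).det := by
  rw [isUnit_iff_ne_zero]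
  intro hdet
  obtain ⟨v, hv0, hv⟩ := Matrix.exists_vecMul_eq_zero_iff.2 hdet
  have hv' (j : Fin r) : ∑ i, v i * (C i j : ℂ) = 0 := congrFun hv j
  have hz : ∑ i, v i • h i = 0 := by
    refine eq_zero_of_forall_lie_eq_zero hL fun y => ?_
    have hy : y ∈ LieSubalgebra.lieSpan ℂ L (Set.range xp ∪ Set.range xm) := by
      rw [hC.generate]; trivial
    induction hy using LieSubalgebra.lieSpan_induction with
    | mem y hy =>
      rw [← lie_skew, neg_eq_zero]
      rcases hy with ⟨j, rfl⟩ | ⟨j, rfl⟩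
      · rw [hC.sum_smul_lie_xp, hv', zero_smul]
      · rw [hC.sum_smul_lie_xm, hv', neg_zero, zero_smul]
    | zero => exact zero_lie _
    | add y y' _ _ hy hy' => rw [add_lie, hy, hy', add_zero]
    | smul a y _ hy => rw [smul_lie, hy, smul_zero]
    | lie y y' _ _ hy hy' => rw [lie_lie, hy, hy', lie_zero, lie_zero, sub_zero]
  exact hv0 (funext (Fintype.linearIndependent_iff.1 hC.linearIndependent v hz))

/-- The element `∑ j, ℓ j h^j` in terms of the coroots `h i`. -/
theorem sum_smul_fundCoweight (ℓ : Fin r → ℂ) :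
    ∑ j, ℓ j • fundCoweight C h j =
      ∑ i, Matrix.vecMul ℓ (C.map (Int.cast : ℤ → ℂ))⁻¹ i • h i := by
  simp only [fundCoweight, Finset.smul_sum, smul_smul, Matrix.vecMul, dotProduct, Finset.sum_smul]
  exact Finset.sum_comm

theorem IsChevalleyGenerators.sum_vecMul_inv (hC : IsChevalleyGenerators C h xp xm)
    (hL : LieAlgebra.IsSimple ℂ L) (ℓ : Fin r → ℂ) (j : Fin r) :
    ∑ i, Matrix.vecMul ℓ (C.map (Int.cast : ℤ → ℂ))⁻¹ i * (C i j : ℂ) = ℓ j := by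
  have h1 : Matrix.vecMul (Matrix.vecMul ℓ (C.map (Int.cast : ℤ → ℂ))⁻¹)
      (C.map (Int.cast : ℤ → ℂ)) = ℓ := by
    rw [Matrix.vecMul_vecMul, Matrix.nonsing_inv_mul _ (hC.isUnit_det hL), Matrix.vecMul_one]
  exact congrFun h1 j

theorem IsChevalleyGenerators.coweight_lie_xp (hC : IsChevalleyGenerators C h xp xm)
    (hL : LieAlgebra.IsSimple ℂ L) (ℓ : Fin r → ℂ) (j : Fin r) :
    ⁅∑ k, ℓ k • fundCoweight C h k, xp j⁆ = ℓ j • xp j := by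
  rw [sum_smul_fundCoweight, hC.sum_smul_lie_xp, hC.sum_vecMul_inv hL]

theorem IsChevalleyGenerators.coweight_lie_xm (hC : IsChevalleyGenerators C h xp xm)
    (hL : LieAlgebra.IsSimple ℂ L) (ℓ : Fin r → ℂ) (j : Fin r) :
    ⁅∑ k, ℓ k • fundCoweight C h k, xm j⁆ = (-ℓ j) • xm j := by
  rw [sum_smul_fundCoweight, hC.sum_smul_lie_xm, hC.sum_vecMul_inv hL]

theorem IsChevalleyGenerators.coweight_lie_coweight (hC : IsChevalleyGenerators C h xp xm)
    (a b : Fin r → ℂ) :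
    ⁅∑ k, a k • fundCoweight C h k, ∑ k, b k • fundCoweight C h k⁆ = 0 := by
  simp [sum_smul_fundCoweight, sum_lie, lie_sum, hC.h_h]

/-- Expresses the torus part of the `SL₂` exchange in coweight coordinates; this is where the shift
of `ℓ` by rows of `C` originates. -/
theorem IsChevalleyGenerators.sum_smul_fundCoweight_row (hC : IsChevalleyGenerators C h xp xm)
    (hL : LieAlgebra.IsSimple ℂ L) (i : Fin r) (m : ℂ) :
    ∑ j, ((C i j : ℂ) * m) • fundCoweight C h j = m • h i := by
  have h1 : Matrix.vecMul (fun j => (C i j : ℂ) * m) (C.map (Int.cast : ℤ → ℂ))⁻¹ =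
      Pi.single i m := by
    have h2 : (fun j => (C i j : ℂ) * m) =
        Matrix.vecMul (Pi.single i m) (C.map (Int.cast : ℤ → ℂ)) := by
      ext j
      simp [Matrix.single_vecMul, mul_comm]
    rw [h2, Matrix.vecMul_vecMul, Matrix.mul_nonsing_inv _ (hC.isUnit_det hL), Matrix.vecMul_one]
  rw [sum_smul_fundCoweight, h1, Finset.sum_eq_single i]
  · simp
  · intro j _ hj; simp [hj]
  · simp

end Cartan

/-! ### Factorisations in `SL₂`. -/

section SL2

variable {n : ℕ} {G : Subgroup (GL (Fin n) ℂ)} {𝔤 : LieSubalgebra ℂ (Matrix (Fin n) (Fin n) ℂ)}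
  {hG : IsSimpleAlgebraicGroup G 𝔤} {h xp xm : 𝔤} {φ : SL(2, ℂ) →* G}

theorem exp_upper (x : ℂ) :
    NormedSpace.exp !![0, x; 0, -0] = (!![1, x; 0, 1] : Matrix (Fin 2) (Fin 2) ℂ) := by
  rw [matrix_exp_of_sq_eq_zero _ (by ext i j; fin_cases i <;> fin_cases j <;> simp [sq]), Matrix.one_fin_two]
  simp

theorem exp_lower (x : ℂ) :
    NormedSpace.exp !![0, 0; x, -0] = (!![1, 0; x, 1] : Matrix (Fin 2) (Fin 2) ℂ) := by
  rw [matrix_exp_of_sq_eq_zero _ (by ext i j; fin_cases i <;> fin_cases j <;> simp [sq]), Matrix.one_fin_two]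
  simp

theorem exp_diag (m : ℂ) :
    NormedSpace.exp !![m, 0; 0, -m] =
      (!![Complex.exp m, 0; 0, Complex.exp (-m)] : Matrix (Fin 2) (Fin 2) ℂ) := by
  have hd (a b : ℂ) : !![a, 0; 0, b] = Matrix.diagonal ![a, b] := by
    ext i j; fin_cases i <;> fin_cases j <;> simp
  rw [hd, hd, Matrix.exp_diagonal]
  congr 1
  ext i
  fin_cases i <;> simp [Pi.coe_exp, Complex.exp_eq_exp_ℂ]

theorem IsSL2Embedding.map_upper (hφ : IsSL2Embedding hG h xp xm φ) (x : ℂ) {g : SL(2, ℂ)}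
    (hg : (g : Matrix (Fin 2) (Fin 2) ℂ) = !![1, x; 0, 1]) : φ g = expG hG (x • xp) := by
  simpa using hφ 0 x 0 g (hg.trans (exp_upper x).symm)

theorem IsSL2Embedding.map_lower (hφ : IsSL2Embedding hG h xp xm φ) (x : ℂ) {g : SL(2, ℂ)}
    (hg : (g : Matrix (Fin 2) (Fin 2) ℂ) = !![1, 0; x, 1]) : φ g = expG hG (x • xm) := by
  simpa using hφ 0 0 x g (hg.trans (exp_lower x).symm)

theorem IsSL2Embedding.map_diag (hφ : IsSL2Embedding hG h xp xm φ) (m : ℂ) {g : SL(2, ℂ)}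
    (hg : (g : Matrix (Fin 2) (Fin 2) ℂ) = !![Complex.exp m, 0; 0, Complex.exp (-m)]) :
    φ g = expG hG (m • h) := by
  simpa using hφ m 0 0 g (hg.trans (exp_diag m).symm)

theorem exists_specialLinear_coe_eq {a b c d : ℂ} (hdet : a * d - b * c = 1) :
    ∃ g : SL(2, ℂ), (g : Matrix (Fin 2) (Fin 2) ℂ) = !![a, b; c, d] :=
  ⟨⟨!![a, b; c, d], by rw [Matrix.det_fin_two_of, hdet]⟩, rfl⟩

theorem coe_gElem (x : ℂ) : (gElem x : Matrix (Fin 2) (Fin 2) ℂ) = !![1 - x, x; -1, 1] :=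
  rfl

theorem IsSL2Embedding.map_gElem (hφ : IsSL2Embedding hG h xp xm φ) (x : ℂ) :
    φ (gElem x) = expG hG (x • xp) * expG hG ((-1 : ℂ) • xm) := by
  obtain ⟨u, hu⟩ := exists_specialLinear_coe_eq (a := 1) (b := x) (c := 0) (d := 1) (by ring)
  obtain ⟨v, hv⟩ := exists_specialLinear_coe_eq (a := 1) (b := 0) (c := -1) (d := 1) (by ring)
  rw [← hφ.map_upper x hu, ← hφ.map_lower (-1) hv, ← map_mul]
  congr 1
  apply Subtype.ext
  rw [Matrix.SpecialLinearGroup.coe_mul, hu, hv, coe_gElem, Matrix.mul_fin_two]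
  congr! 3 <;> ring_nf

/-- The diagonal-lower-upper factorisation of `gElem x`, available because its top left entry `1 - x
= e^m` is nonzero. -/
theorem IsSL2Embedding.map_gElem_eq (hφ : IsSL2Embedding hG h xp xm φ) {x m : ℂ}
    (hm : Complex.exp m = 1 - x) :
    φ (gElem x) = expG hG (m • h) *
      (expG hG ((-Complex.exp m) • xm) * expG hG ((x * Complex.exp (-m)) • xp)) := by
  have h1 : Complex.exp m * Complex.exp (-m) = 1 := by rw [← Complex.exp_add]; simp
  obtain ⟨u, hu⟩ := exists_specialLinear_coe_eq (a := 1) (b := x * Complex.exp (-m)) (c := 0)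
    (d := 1) (by ring)
  obtain ⟨v, hv⟩ := exists_specialLinear_coe_eq (a := 1) (b := 0) (c := -Complex.exp m) (d := 1)
    (by ring)
  obtain ⟨w, hw⟩ := exists_specialLinear_coe_eq (a := Complex.exp m) (b := 0) (c := 0)
    (d := Complex.exp (-m)) (by rw [h1]; ring)
  rw [← hφ.map_upper _ hu, ← hφ.map_lower _ hv, ← hφ.map_diag m hw, ← map_mul, ← map_mul]
  congr 1
  apply Subtype.ext
  rw [Matrix.SpecialLinearGroup.coe_mul, Matrix.SpecialLinearGroup.coe_mul, hu, hv, hw, coe_gElem,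
    Matrix.mul_fin_two, Matrix.mul_fin_two]
  ext i j
  fin_cases i <;> fin_cases j <;> simp
  · rw [hm]
  · linear_combination -x * h1
  · linear_combination -h1
  · linear_combination (x * Complex.exp (-m) - 1) * h1 + Complex.exp (-m) * hm

end SL2

/-! ### Invariance of the character under the Toda map. -/

section Character

variable {n r : ℕ} {G : Subgroup (GL (Fin n) ℂ)}
  {𝔤 : LieSubalgebra ℂ (Matrix (Fin n) (Fin n) ℂ)} {hG : IsSimpleAlgebraicGroup G 𝔤}
  {C : Matrix (Fin r) (Fin r) ℤ} {h xp xm : Fin r → 𝔤} {φ : Fin r → SL(2, ℂ) →* G}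
  {σ : Equiv.Perm (Fin r)} {V : Type*} [AddCommGroup V] [Module ℂ V] {ρ : Representation ℂ G V}

theorem expG_coweight_add (hG : IsSimpleAlgebraicGroup G 𝔤) (hC : IsChevalleyGenerators C h xp xm)
    (a b : Fin r → ℂ) :
    expG hG (∑ j, (a + b) j • fundCoweight C h j) =
      expG hG (∑ j, a j • fundCoweight C h j) * expG hG (∑ j, b j • fundCoweight C h j) := by
  rw [← expG_add hG (hC.coweight_lie_coweight a b)]
  simp only [Pi.add_apply, add_smul, Finset.sum_add_distrib]

theorem isPinning (hC : IsChevalleyGenerators C h xp xm)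
    (hφ : ∀ i, IsSL2Embedding hG (h i) (xp i) (xm i) (φ i)) :
    IsPinning C (fun a => expG hG (∑ j, a j • fundCoweight C h j))
      (fun i t => expG hG (t • xp i)) (fun i t => expG hG (t • xm i)) where
  torus_add := expG_coweight_add hG hC
  torus_e a i t := semiconjBy_expG hG (hC.coweight_lie_xp hG.simple a i) t
  torus_f a i t := semiconjBy_expG hG (hC.coweight_lie_xm hG.simple a i) t
  commute i j s t hij := commute_expG hG (by
    rw [smul_lie, lie_smul, hC.xp_xm, if_neg hij, smul_zero, smul_zero])
  exchange i x m hm := by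
    rw [← (hφ i).map_gElem, (hφ i).map_gElem_eq hm, hC.sum_smul_fundCoweight_row hG.simple]

theorem groupElem_eq (hφ : ∀ i, IsSL2Embedding hG (h i) (xp i) (xm i) (φ i)) (ℓ : Fin r → ℂ)
    (χ : Point r) :
    groupElem hG C h φ σ ℓ χ = expG hG (∑ j, ℓ j • fundCoweight C h j) *
      ((List.ofFn σ).map fun k =>
        expG hG (χ.2 k • xp k) * expG hG ((-1 : ℂ) • xm k)).prod := by
  rw [groupElem, List.map_ofFn]
  congr 3
  ext1 k
  exact (hφ (σ k)).map_gElem _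

theorem trace_eq_of_isConj {Γ : Type*} [Group Γ] {ρ : Representation ℂ Γ V} {a b : Γ}
    (hab : IsConj a b) : LinearMap.trace ℂ V (ρ a) = LinearMap.trace ℂ V (ρ b) := by
  obtain ⟨c, rfl⟩ := isConj_iff.1 hab
  rw [map_mul, LinearMap.trace_mul_comm, ← map_mul, ← mul_assoc, inv_mul_cancel, one_mul]

theorem todaMap_ratio {χ : Point r} (hχ : InDomain χ) (j : Fin r) :
    (todaMap C χ).1 j / (todaMap C χ).2 j = χ.1 j / χ.2 j * ∏ k, (1 - χ.2 k) ^ C k j := by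
  have hprod : (∏ k, (1 - χ.2 k) ^ C k j) ≠ 0 := Finset.prod_ne_zero_iff.2 fun k _ =>
    zpow_ne_zero _ (sub_ne_zero.2 (hχ k).2.2.symm)
  obtain ⟨h1, h2, -⟩ := hχ j
  simp only [todaMap, zpow_neg, Finset.prod_inv_distrib]
  field_simp

theorem exp_sum_cartan {χ : Point r} {m : Fin r → ℂ}
    (hm : ∀ j, Complex.exp (m j) = 1 - χ.2 j) (j : Fin r) :
    Complex.exp (∑ k, (C k j : ℂ) * m k) = ∏ k, (1 - χ.2 k) ^ C k j := by
  simp only [Complex.exp_sum, Complex.exp_int_mul, hm]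

theorem isLogRatio_todaMap_iff {χ : Point r} (hχ : InDomain χ) {ℓ m ℓ' : Fin r → ℂ}
    (hm : ∀ j, Complex.exp (m j) = 1 - χ.2 j)
    (hℓ' : ∀ j, ℓ' j = ℓ j + ∑ k, (C k j : ℂ) * m k) :
    IsLogRatio ℓ' (todaMap C χ) ↔ IsLogRatio ℓ χ := by
  refine forall_congr' fun j => ?_
  rw [todaMap_ratio hχ, hℓ', Complex.exp_add, ← exp_sum_cartan hm]
  exact mul_left_inj' (Complex.exp_ne_zero _)

/-- Since the new `χ⁺` is the old `χ⁻`, dividing it by the new ratio `e^{ℓ'}` gives the new `χ⁻`.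
This matches the Toda map with the conjugated parameters. -/
theorem todaMap_snd_eq {χ : Point r} (hχ : InDomain χ) {ℓ' : Fin r → ℂ}
    (hℓ' : IsLogRatio ℓ' (todaMap C χ)) (j : Fin r) :
    (todaMap C χ).2 j = χ.2 j * Complex.exp (-ℓ' j) := by
  rw [Complex.exp_neg, hℓ' j, inv_div]
  exact (mul_div_cancel₀ _ (hχ j).2.1).symm

theorem chBranch_todaMap (hC : IsChevalleyGenerators C h xp xm)
    (hφ : ∀ i, IsSL2Embedding hG (h i) (xp i) (xm i) (φ i)) {χ : Point r} (hχ : InDomain χ)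
    {ℓ m ℓ' : Fin r → ℂ} (hℓ : IsLogRatio ℓ χ) (hm : ∀ j, Complex.exp (m j) = 1 - χ.2 j)
    (hℓ' : ∀ j, ℓ' j = ℓ j + ∑ k, (C k j : ℂ) * m k) :
    chBranch hG C h φ σ ρ ℓ' (todaMap C χ) = chBranch hG C h φ σ ρ ℓ χ := by
  have hlog := (isLogRatio_todaMap_iff hχ hm hℓ').2 hℓ
  refine (trace_eq_of_isConj ?_).symm
  rw [groupElem_eq hφ, groupElem_eq hφ]
  simp only [todaMap_snd_eq hχ hlog]
  refine (isPinning hC hφ).isConj_coxeter hm (List.ofFn σ) (List.nodup_ofFn.2 σ.injective)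
    fun j => ?_
  rw [hℓ', List.map_ofFn, List.sum_ofFn]
  exact congrArg _ (Equiv.sum_comp σ fun k => (C k j : ℂ) * m k).symm

theorem exists_exp_eq_one_sub {χ : Point r} (hχ : InDomain χ) :
    ∃ m : Fin r → ℂ, ∀ j, Complex.exp (m j) = 1 - χ.2 j :=
  ⟨fun j => Complex.log (1 - χ.2 j), fun j =>
    Complex.exp_log (sub_ne_zero.2 (hχ j).2.2.symm)⟩

/-- For a fixed choice of `m`, the shift by `∑ k, C k j * m k` is a bijection between the logarithms
at `χ` and those at its image. -/
theorem chValues_todaMap (hC : IsChevalleyGenerators C h xp xm)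
    (hφ : ∀ i, IsSL2Embedding hG (h i) (xp i) (xm i) (φ i)) {χ : Point r} (hχ : InDomain χ) :
    chValues hG C h φ σ ρ (todaMap C χ) = chValues hG C h φ σ ρ χ := by
  obtain ⟨m, hm⟩ := exists_exp_eq_one_sub hχ
  ext c
  constructor
  · rintro ⟨ℓ', hlog, rfl⟩
    have hℓ' (j : Fin r) : ℓ' j = (ℓ' j - ∑ k, (C k j : ℂ) * m k) + ∑ k, (C k j : ℂ) * m k := by
      ring
    have hℓ := (isLogRatio_todaMap_iff hχ hm hℓ').1 hlog
    exact ⟨_, hℓ, chBranch_todaMap hC hφ hχ hℓ hm hℓ'⟩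
  · rintro ⟨ℓ, hℓ, rfl⟩
    exact ⟨_, (isLogRatio_todaMap_iff hχ hm fun _ => rfl).2 hℓ,
      (chBranch_todaMap hC hφ hχ hℓ hm fun _ => rfl).symm⟩

theorem CoweightsIntegral.map_expG_eq_one (hI : CoweightsIntegral hG C h ρ)
    (hC : IsChevalleyGenerators C h xp xm) (N : Fin r → ℤ) :
    ρ (expG hG (∑ j, ((N j : ℂ) * (2 * Real.pi * Complex.I)) • fundCoweight C h j)) = 1 := by
  have hadd (a b : Fin r → ℂ) := congrArg ρ (expG_coweight_add hG hC a b)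
  have h0 : expG hG (∑ j, (0 : Fin r → ℂ) j • fundCoweight C h j) = 1 := by
    have := expG_coweight_add hG hC 0 0
    rw [add_zero] at this
    exact left_eq_mul.1 this
  -- The exponents acting trivially form a group, so it is enough to check the generators `2πi` in
  -- one coordinate.
  let K : AddSubgroup (Fin r → ℂ) :=
    { carrier := {a | ρ (expG hG (∑ j, a j • fundCoweight C h j)) = 1}
      zero_mem' := by rw [Set.mem_ofPred_eq, h0, map_one]
      add_mem' := fun {a b} ha hb => by
        rw [Set.mem_ofPred_eq] at ha hb ⊢
        rw [hadd, map_mul, ha, hb, one_mul]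
      neg_mem' := fun {a} ha => by
        rw [Set.mem_ofPred_eq] at ha ⊢
        have := hadd a (-a)
        rw [add_neg_cancel, h0, map_one, map_mul, ha, one_mul] at this
        exact this.symm }
  have hsingle (j : Fin r) : Pi.single j (2 * Real.pi * Complex.I : ℂ) ∈ K := by
    change ρ (expG hG (∑ k, _)) = 1
    rw [Finset.sum_eq_single j (fun k _ hk => by simp [hk]) (by simp), Pi.single_eq_same]
    exact hI j
  have hmem : ∑ j, N j • Pi.single j (2 * Real.pi * Complex.I : ℂ) ∈ K :=
    sum_mem fun j _ => zsmul_mem (hsingle j) _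
  have heq : ∑ j, N j • Pi.single j (2 * Real.pi * Complex.I : ℂ) =
      fun j => (N j : ℂ) * (2 * Real.pi * Complex.I) := by
    ext j
    simp [Finset.sum_apply, Pi.single_apply]
  rw [heq] at hmem
  exact hmem

theorem CoweightsIntegral.chBranch_eq (hI : CoweightsIntegral hG C h ρ)
    (hC : IsChevalleyGenerators C h xp xm) {χ : Point r} {ℓ₁ ℓ₂ : Fin r → ℂ}
    (h₁ : IsLogRatio ℓ₁ χ) (h₂ : IsLogRatio ℓ₂ χ) :
    chBranch hG C h φ σ ρ ℓ₁ χ = chBranch hG C h φ σ ρ ℓ₂ χ := by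
  have hN (j : Fin r) := Complex.exp_eq_exp_iff_exists_int.1 ((h₁ j).trans (h₂ j).symm)
  choose N hN using hN
  have hsum : ℓ₁ = (fun j => (N j : ℂ) * (2 * Real.pi * Complex.I)) + ℓ₂ := by
    ext j
    rw [hN j, Pi.add_apply, add_comm]
  rw [chBranch, chBranch, groupElem, groupElem, hsum, expG_coweight_add hG hC, mul_assoc, map_mul,
    hI.map_expG_eq_one hC, one_mul]

theorem isLogRatio_log {χ : Point r} (hχ : ∀ j, χ.1 j / χ.2 j ≠ 0) :
    IsLogRatio (fun j => Complex.log (χ.1 j / χ.2 j)) χ :=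
  fun j => Complex.exp_log (hχ j)

theorem CoweightsIntegral.chBranch_eq_ch (hI : CoweightsIntegral hG C h ρ)
    (hC : IsChevalleyGenerators C h xp xm) {χ : Point r} {ℓ : Fin r → ℂ} (hℓ : IsLogRatio ℓ χ) :
    chBranch hG C h φ σ ρ ℓ χ = ch hG C h φ σ ρ χ :=
  -- The ratio is nonzero because it is an exponential, so `χ` need not lie in the domain of the
  -- map.
  hI.chBranch_eq hC hℓ (isLogRatio_log fun j => hℓ j ▸ Complex.exp_ne_zero _)

theorem CoweightsIntegral.ch_todaMap (hI : CoweightsIntegral hG C h ρ)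
    (hC : IsChevalleyGenerators C h xp xm)
    (hφ : ∀ i, IsSL2Embedding hG (h i) (xp i) (xm i) (φ i)) {χ : Point r} (hχ : InDomain χ) :
    ch hG C h φ σ ρ (todaMap C χ) = ch hG C h φ σ ρ χ := by
  obtain ⟨m, hm⟩ := exists_exp_eq_one_sub hχ
  have hℓ := isLogRatio_log fun j => div_ne_zero (hχ j).1 (hχ j).2.1
  rw [← hI.chBranch_eq_ch hC ((isLogRatio_todaMap_iff hχ hm fun _ => rfl).2 hℓ),
    chBranch_todaMap hC hφ hχ hℓ hm fun _ => rfl]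
  rfl

end Character

end CoxeterToda

theorem mainTheorem1 {n r : ℕ} (G : Subgroup (GL (Fin n) ℂ))
    (𝔤 : LieSubalgebra ℂ (Matrix (Fin n) (Fin n) ℂ))
    (hG : CoxeterToda.IsSimpleAlgebraicGroup G 𝔤)
    (C : Matrix (Fin r) (Fin r) ℤ) (h xp xm : Fin r → 𝔤)
    (hC : CoxeterToda.IsChevalleyGenerators C h xp xm)
    (φ : Fin r → SL(2, ℂ) →* G)
    (hφ : ∀ i, CoxeterToda.IsSL2Embedding hG (h i) (xp i) (xm i) (φ i))
    (σ : Equiv.Perm (Fin r))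
    {V : Type*} [AddCommGroup V] [Module ℂ V] [FiniteDimensional ℂ V]
    (ρ : Representation ℂ G V) :
    -- every branch of the character, continued along with the map, is preserved
    (∀ χ : CoxeterToda.Point r, CoxeterToda.InDomain χ →
      ∀ ℓ m ℓ' : Fin r → ℂ, CoxeterToda.IsLogRatio ℓ χ →
        (∀ j, Complex.exp (m j) = 1 - χ.2 j) →
        (∀ j, ℓ' j = ℓ j + ∑ k, (C k j : ℂ) * m k) →
        CoxeterToda.IsLogRatio ℓ' (CoxeterToda.todaMap C χ) ∧
        CoxeterToda.chBranch hG C h φ σ ρ ℓ' (CoxeterToda.todaMap C χ) =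
          CoxeterToda.chBranch hG C h φ σ ρ ℓ χ) ∧
    -- the multivalued character is an integral
    CoxeterToda.IsIntegralOf (CoxeterToda.todaRel C)
      (CoxeterToda.chValues hG C h φ σ ρ) ∧
    -- the single-valued characters are integrals
    (CoxeterToda.CoweightsIntegral hG C h ρ →
      (∀ χ : CoxeterToda.Point r, ∀ ℓ : Fin r → ℂ, CoxeterToda.IsLogRatio ℓ χ →
        CoxeterToda.chBranch hG C h φ σ ρ ℓ χ = CoxeterToda.ch hG C h φ σ ρ χ) ∧
      CoxeterToda.IsIntegralOf (CoxeterToda.todaRel C) (CoxeterToda.ch hG C h φ σ ρ)) := by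
  refine ⟨fun χ hχ ℓ m ℓ' hℓ hm hℓ' => ⟨(CoxeterToda.isLogRatio_todaMap_iff hχ hm hℓ').2 hℓ,
    CoxeterToda.chBranch_todaMap hC hφ hχ hℓ hm hℓ'⟩, ?_, fun hI => ⟨fun χ ℓ hℓ =>
    hI.chBranch_eq_ch hC hℓ, ?_⟩⟩
  · rintro χ _ ⟨hχ, rfl⟩
    exact (CoxeterToda.chValues_todaMap hC hφ hχ).symm
  · rintro χ _ ⟨hχ, rfl⟩
    exact (hI.ch_todaMap hC hφ hχ).symm
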